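/- Let $\mathbb{U}_0$ be the rational Urysohn space, i.e. the Fraïssé limit of the class of finite metric spaces with rational distances: the countable metric space, unique up to isometry, such that every isometry between finite subspaces extends to an isometry of $\mathbb{U}_0$ onto itself, all distances are rational, and every finite metric space with rational distances embeds isometrically. Let $G=\mathrm{Aut}(\mathbb{U}_0)$ be its group of isometries, with the topology of pointwise convergence for which $\mathbb{U}_0$ is discrete (so $G$ is a Polish group). Let $(X,\mu)$ be a standard Borel space with a non-atomic probability measure, and let $L_0(G)=L_0(X,\mu;G)$ be the group of $\mu$-equivalence classes of measurable functions $X\to G$ under pointwise multiplication, with the topology of convergence in measure. For a topological group $H$, say that $(g,h)\in H^2$ cyclically generates $H$ if $\{g^{l}hg^{-l} : l\in\mathbb{Z}\}$ is dense in $H$; in that case $H$ is said to have a cyclically dense conjugacy class. Then each of the groups $G^n$, $n\ge 1$, and $L_0(G)$ has a cyclically dense conjugacy class. In fact, each of these groups is cyclically generated by a pair $(g,h)$ which generates the free group, i.e. is a free basis of the subgroup that it generates. -/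

import Mathlib

open MeasureTheory TopologicalSpace

/-! ### Cyclic generation and free pairs -/

section Groups

variable {H : Type*} [Group H]

/-- `(g, h)` topologically cyclically generates `H`: the set `{g ^ l * h * g ^ (-l) : l ∈ ℤ}`
is dense in `H`. -/
def CyclicallyGenerates [TopologicalSpace H] (g h : H) : Prop :=
  Dense (Set.range fun l : ℤ => g ^ l * h * g ^ (-l))

/-- `H` has a cyclically dense conjugacy class. -/
def HasCyclicallyDenseConjClass (H : Type*) [Group H] [TopologicalSpace H] : Prop :=
  ∃ g h : H, CyclicallyGenerates g h

/-- `g` and `h` generate the free group: the subgroup generated by `g` and `h` is free of rank two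
with basis `(g, h)`, i.e. no nontrivial reduced word in two letters vanishes at `(g, h)`. -/
def GeneratesFreeGroup (g h : H) : Prop :=
  Function.Injective (FreeGroup.lift ![g, h] : FreeGroup (Fin 2) →* H)

end Groups

/-! ### The rational Urysohn space -/

/-- All distances are rational numbers. -/
def HasRationalDistances (A : Type*) [MetricSpace A] : Prop :=
  ∀ a b : A, ∃ q : ℚ, dist a b = (q : ℝ)

/-- `U` is (a copy of) the rational Urysohn space, i.e. the Fraïssé limit of the class of finite
metric spaces with rational distances: it is countable and ultrahomogeneous, and its finite
subspaces are, up to isometry, exactly the finite metric spaces with rational distances. -/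
class RationalUrysohnSpace (U : Type*) [MetricSpace U] : Prop extends Countable U where
  rational : HasRationalDistances U
  universal : ∀ (A : Type) [MetricSpace A] [Finite A], HasRationalDistances A →
    ∃ f : A → U, Isometry f
  ultrahomogeneous : ∀ (S : Set U), S.Finite → ∀ f : S → U, Isometry f →
    ∃ g : U ≃ᵢ U, ∀ x : S, g x = f x

/-! ### The Polish group of automorphisms of a countable metric space -/

section Aut

/-- The set `α` regarded as a discrete topological space. -/
def DiscreteCopy (α : Type*) : Type _ := α

/-- The identity map from `α` to its discrete copy. -/
def toDiscrete {α : Type*} (a : α) : DiscreteCopy α := a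

instance (α : Type*) : TopologicalSpace (DiscreteCopy α) := ⊥

instance (α : Type*) : DiscreteTopology (DiscreteCopy α) := ⟨rfl⟩

instance (α : Type*) [Countable α] : Countable (DiscreteCopy α) := inferInstanceAs (Countable α)

variable {U : Type*} [MetricSpace U]

/-- The topology of pointwise convergence on the automorphism group of `U`, where `U` is a
countable structure and hence carries the discrete topology: the sets `{g | g x = y}`,
for `x y : U`, form a subbasis. -/
instance autTopology : TopologicalSpace (U ≃ᵢ U) :=
  TopologicalSpace.induced (fun g (x : U) => toDiscrete (g x)) inferInstance

theorem isOpen_setOf_apply_eq (x y : U) : IsOpen {g : U ≃ᵢ U | g x = y} := by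
  refine isOpen_induced_iff.2 ⟨{f : U → DiscreteCopy U | f x = toDiscrete y},
    ?_, rfl⟩
  exact (isOpen_discrete ({toDiscrete y} : Set (DiscreteCopy U))).preimage
    (continuous_apply (A := fun _ : U => DiscreteCopy U) x)

theorem continuous_to_aut {Z : Type*} [TopologicalSpace Z] {F : Z → (U ≃ᵢ U)}
    (hF : ∀ x y : U, IsOpen {z | F z x = y}) : Continuous F := by
  refine continuous_induced_rng.2 (continuous_pi fun x => ?_)
  refine continuous_discrete_rng.2 fun y => ?_
  exact hF x y

instance aut_isTopologicalGroup : IsTopologicalGroup (U ≃ᵢ U) where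
  continuous_mul := by
    refine continuous_to_aut fun x y => ?_
    have : {z : (U ≃ᵢ U) × (U ≃ᵢ U) | (z.1 * z.2) x = y} =
        ⋃ w : U, {g | g w = y} ×ˢ {h | h x = w} := by
      ext z
      simp [IsometryEquiv.mul_apply]
    rw [this]
    exact isOpen_iUnion fun w => (isOpen_setOf_apply_eq w y).prod (isOpen_setOf_apply_eq x w)
  continuous_inv := by
    refine continuous_to_aut fun x y => ?_
    have : {g : U ≃ᵢ U | g⁻¹ x = y} = {g | g y = x} := by
      ext g
      constructor
      · rintro h
        have h' : g.symm x = y := h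
        simp [← h']
      · rintro h
        have h' : g y = x := h
        show g.symm x = y
        simp [← h']
    rw [this]
    exact isOpen_setOf_apply_eq y x

/-- An automorphism together with its inverse, as a pair of functions. -/
def autPair (g : U ≃ᵢ U) : (U → DiscreteCopy U) × (U → DiscreteCopy U) :=
  (fun x => toDiscrete (g x), fun x => toDiscrete (g.symm x))

theorem isClosedEmbedding_autPair : Topology.IsClosedEmbedding (autPair (U := U)) := by
  have h1 : Continuous fun g : U ≃ᵢ U => (fun x : U => toDiscrete (g x)) :=
    continuous_induced_dom
  have h2 : Continuous (autPair (U := U)) := h1.prodMk (h1.comp continuous_inv)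
  have hind : Topology.IsInducing (autPair (U := U)) :=
    Topology.IsInducing.of_comp h2 continuous_fst ⟨rfl⟩
  refine ⟨⟨hind, ?_⟩, ?_⟩
  · intro g h hgh
    ext x
    exact congrFun (congrArg Prod.fst hgh) x
  · have hrange : Set.range (autPair (U := U)) =
        {p | ∀ x y : U, (p.1 x = y ↔ p.2 y = x) ∧
          dist (show U from p.1 x) (show U from p.1 y) = dist x y} := by
      ext p
      constructor
      · rintro ⟨g, rfl⟩ x y
        refine ⟨⟨fun h => ?_, fun h => ?_⟩, g.dist_eq x y⟩
        · have h' : g x = y := h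
          exact g.symm_apply_eq.2 h'.symm
        · have h' : g.symm y = x := h
          exact (g.symm_apply_eq.1 h').symm
      · intro hp
        exact ⟨⟨⟨p.1, p.2, fun x => ((hp x _).1.1 rfl), fun y => ((hp _ y).1.2 rfl)⟩,
          Isometry.of_dist_eq fun x y => (hp x y).2⟩, rfl⟩
    rw [hrange]
    have key : ∀ (s : Set ((DiscreteCopy U × DiscreteCopy U) × DiscreteCopy U)) (x y : U),
        IsClosed {p : (U → DiscreteCopy U) × (U → DiscreteCopy U) |
          ((p.1 x, p.1 y), p.2 y) ∈ s} := fun s x y =>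
      (isClosed_discrete s).preimage (by fun_prop)
    simp only [Set.ofPred_forall]
    exact isClosed_iInter fun x => isClosed_iInter fun y =>
      key {q | (q.1.1 = y ↔ q.2 = x) ∧
        dist (show U from q.1.1) (show U from q.1.2) = dist x y} x y

instance aut_polishSpace [Countable U] : PolishSpace (U ≃ᵢ U) :=
  haveI : SecondCountableTopology (DiscreteCopy U) :=
    DiscreteTopology.secondCountableTopology_of_countable
  haveI : PolishSpace (U → DiscreteCopy U) :=
    { toSecondCountableTopology := inferInstance
      toIsCompletelyMetrizableSpace := inferInstance }
  isClosedEmbedding_autPair.polishSpace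

end Aut

/-! ### Groups of measurable functions -/

section L0

variable {X : Type*} [MeasurableSpace X]

/-- `L₀(X, μ; Y)`: classes modulo `μ`-almost everywhere equality of measurable functions from `X`
to the Polish space `Y`. When `Y` is a Polish group, this is a group under pointwise
multiplication. -/
abbrev LZero (μ : Measure X) (Y : Type*) [TopologicalSpace Y] [PolishSpace Y] : Type _ :=
  X →ₘ[μ] Y

/-- The topology of convergence in measure on `L₀(X, μ; Y)`, for a probability measure `μ`. It is
generated by the sets `[h, δ, ε] = {g | μ {x | d (g x) (h x) < δ} > 1 - ε}`, where `d` is a fixed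
compatible complete metric on `Y`. -/
noncomputable instance lZeroTopology (μ : Measure X) [IsProbabilityMeasure μ]
    (Y : Type*) [TopologicalSpace Y] [PolishSpace Y] : TopologicalSpace (LZero μ Y) :=
  letI := upgradeIsCompletelyMetrizable Y
  TopologicalSpace.generateFrom
    {s | ∃ (h : LZero μ Y) (δ ε : ℝ), 0 < δ ∧ 0 < ε ∧
      s = {g : LZero μ Y | μ.real {x | dist (g x) (h x) < δ} > 1 - ε}}

end L0

/-! Write G for the isometry group of U. Everything rests on one g in G such that every finite set F
has a power g^n with d(g^n a, b) equal to a single constant for all a, b in F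
(`exists_movesToConstantDistance`). The values of an isometry on F and on g^(-n)F can then be
prescribed independently, so conjugation by powers of g is topologically transitive, and by Baire
category a generic h gives a cyclically generating pair (g, h).

The element g is a union of finite partial isometries carrying a grading that rises by one along
each arrow. The grading rules out cycles and lets a path be prolonged until its end is at the
constant distance (`exists_graded_extension`).

Transitivity is proved in C(K, G), K compact, with g as a constant function
(`MovesToConstantDistance.exists_conj_mem`). The finite space `Fin n` gives G^n. For Cantor space K,
a Borel embedding X → K induces a continuous homomorphism from C(K, G) onto a dense subgroup of
L₀(G), and cyclic generation passes along such maps.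

For freeness, the equation w(g, x) = 1 is closed in x and invariant under conjugating x by g; if h
satisfied it, so would every x. But nonzero powers of g have no fixed points, so a reduced word can
be followed along fresh points (`MovesToConstantDistance.exists_path`) and is not identically
trivial. -/

/-! ### Partial isometries of the rational Urysohn space -/

section PartialIsometries

variable {U : Type*} [MetricSpace U]

/-- The relation `R` is (the graph of) a partial isometry. -/
def IsPartialIsometry (R : Set (U × U)) : Prop :=
  ∀ p ∈ R, ∀ q ∈ R, dist p.2 q.2 = dist p.1 q.1

/-- The automorphism `g` extends the relation `R`. -/
def Extends (g : U ≃ᵢ U) (R : Set (U × U)) : Prop := ∀ p ∈ R, g p.1 = p.2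

theorem Extends.mono {g : U ≃ᵢ U} {R S : Set (U × U)} (h : Extends g S) (hRS : R ⊆ S) :
    Extends g R := fun p hp => h p (hRS hp)

theorem IsPartialIsometry.exists_equiv_of_total {R : Set (U × U)} (hR : IsPartialIsometry R)
    (hdom : ∀ x, ∃ y, (x, y) ∈ R) (hran : ∀ y, ∃ x, (x, y) ∈ R) :
    ∃ g : U ≃ᵢ U, Extends g R := by
  choose f hf using hdom
  choose f' hf' using hran
  have hfun : ∀ x y, (x, y) ∈ R → f x = y := fun x y h => by
    rw [← dist_eq_zero, hR _ (hf x) _ h, dist_self]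
  have hinj : ∀ x y, (x, y) ∈ R → f' y = x := fun x y h => by
    rw [← dist_eq_zero, ← hR _ (hf' y) _ h, dist_self]
  refine ⟨⟨⟨f, f', fun x => hinj _ _ (hf x), fun y => hfun _ _ (hf' y)⟩,
    Isometry.of_dist_eq fun x y => hR _ (hf x) _ (hf y)⟩, fun p hp => hfun _ _ hp⟩

variable [RationalUrysohnSpace U]

theorem IsPartialIsometry.exists_equiv {R : Set (U × U)} (hR : IsPartialIsometry R)
    (hfin : R.Finite) : ∃ g : U ≃ᵢ U, Extends g R := by
  have hex : ∀ x : Prod.fst '' R, ∃ y, ((x : U), y) ∈ R := by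
    rintro ⟨_, ⟨⟨x, y⟩, h, rfl⟩⟩
    exact ⟨y, h⟩
  choose f hf using hex
  obtain ⟨g, hg⟩ := RationalUrysohnSpace.ultrahomogeneous (Prod.fst '' R) (hfin.image _) f
    (Isometry.of_dist_eq fun x y => hR _ (hf x) _ (hf y))
  refine ⟨g, fun p hp => ?_⟩
  rw [hg ⟨p.1, p, hp, rfl⟩, ← dist_eq_zero, hR _ (hf _) _ hp, dist_self]

/-- The finite set `Fin n` without its standard topology. -/
structure FinPoint (n : ℕ) : Type where
  /-- The underlying index. -/
  index : Fin n

/-- A finite type is in bijection with some `FinPoint n`. -/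
theorem exists_equiv_finPoint (ι : Type*) [Finite ι] : ∃ n, Nonempty (ι ≃ FinPoint n) := by
  obtain ⟨n, ⟨e⟩⟩ := Finite.exists_equiv_fin ι
  exact ⟨n, ⟨e.trans ⟨FinPoint.mk, FinPoint.index, fun _ => rfl, fun _ => rfl⟩⟩⟩

/-- A partial embedding of a finite rational pseudometric space into the rational Urysohn space
extends to the whole space. -/
theorem exists_extend_embedding {ι : Type*} [Finite ι] (σ : ι → ι → ℝ)
    (hself : ∀ i, σ i i = 0) (hcomm : ∀ i j, σ i j = σ j i)
    (htri : ∀ i j k, σ i k ≤ σ i j + σ j k) (hrat : ∀ i j, ∃ q : ℚ, σ i j = q)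
    (s : Set ι) (f : ι → U) (hf : ∀ i ∈ s, ∀ j ∈ s, dist (f i) (f j) = σ i j) :
    ∃ ψ : ι → U, (∀ i j, dist (ψ i) (ψ j) = σ i j) ∧ ∀ i ∈ s, ψ i = f i := by
  -- Universality concerns spaces in `Type`, so the index set is first transported there.
  obtain ⟨n, ⟨e⟩⟩ := exists_equiv_finPoint ι
  have : Finite (FinPoint n) := .of_equiv ι e
  let _ : PseudoMetricSpace (FinPoint n) :=
    { dist := fun i j => σ (e.symm i) (e.symm j)
      dist_self := fun i => hself _
      dist_comm := fun i j => hcomm _ _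
      dist_triangle := fun i j k => htri _ _ _ }
  have hd : ∀ i j : FinPoint n, dist (SeparationQuotient.mk i) (SeparationQuotient.mk j) =
      σ (e.symm i) (e.symm j) := fun i j => SeparationQuotient.dist_mk i j
  have : Finite (SeparationQuotient (FinPoint n)) :=
    Finite.of_surjective _ SeparationQuotient.surjective_mk
  obtain ⟨F, hF⟩ := RationalUrysohnSpace.universal (U := U) (SeparationQuotient (FinPoint n)) (by
    intro a b
    obtain ⟨i, rfl⟩ := SeparationQuotient.surjective_mk a
    obtain ⟨j, rfl⟩ := SeparationQuotient.surjective_mk b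
    rw [hd]
    exact hrat _ _)
  set φ : ι → U := fun i => F (SeparationQuotient.mk (e i)) with hφ
  have hφd : ∀ i j, dist (φ i) (φ j) = σ i j := fun i j => by
    rw [hφ, hF.dist_eq, hd, e.symm_apply_apply, e.symm_apply_apply]
  -- The copy φ ignores f; ultrahomogeneity moves it so that the two agree on s.
  obtain ⟨g, hg⟩ := IsPartialIsometry.exists_equiv (R := (fun i => (φ i, f i)) '' s) (by
    rintro _ ⟨i, hi, rfl⟩ _ ⟨j, hj, rfl⟩
    rw [hf i hi j hj, hφd]) (s.toFinite.image _)
  exact ⟨fun i => g (φ i), fun i j => by rw [g.dist_eq, hφd], fun i hi => hg _ ⟨i, hi, rfl⟩⟩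

theorem exists_dist_eq_ratCast (x y : U) : ∃ q : ℚ, dist x y = q :=
  RationalUrysohnSpace.rational x y

/-- An extending automorphism already offers g a as image of a, but g a may lie in B. The image is
replaced by a point with the same distances to the range of R and positive distance to all of B. -/
theorem IsPartialIsometry.exists_insert {R : Set (U × U)} (hR : IsPartialIsometry R)
    (hfin : R.Finite) {a : U} (ha : ∀ p ∈ R, p.1 ≠ a) {B : Set U} (hB : B.Finite) :
    ∃ b ∉ B, IsPartialIsometry (insert (a, b) R) := by
  obtain ⟨g, hg⟩ := hR.exists_equiv hfin
  obtain ⟨κ, hκ, hκR⟩ : ∃ κ : ℚ, 0 < κ ∧ ∀ p ∈ R, (κ : ℝ) ≤ dist (g a) p.2 := by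
    have hpos : ∀ p ∈ R, 0 < dist (g a) p.2 := fun p hp => by
      rw [← hg p hp, g.dist_eq]
      exact dist_pos.2 (ha p hp).symm
    rcases R.eq_empty_or_nonempty with rfl | hne
    · exact ⟨1, one_pos, by simp⟩
    · obtain ⟨p, hp, hmin⟩ := hfin.exists_minimalFor (fun p => dist (g a) p.2) R hne
      obtain ⟨q, hq0, hq⟩ := exists_rat_btwn (hpos p hp)
      refine ⟨q, by exact_mod_cast hq0, fun p' hp' => ?_⟩
      rcases le_total (dist (g a) p.2) (dist (g a) p'.2) with h | h
      · exact hq.le.trans h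
      · exact hq.le.trans (hmin hp' h)
  set E : Set U := Prod.snd '' R ∪ B with hE
  have : Finite E := ((hfin.image _).union hB).to_subtype
  have hκ' : (0 : ℝ) < κ := by exact_mod_cast hκ
  -- The new point lies at distance max(d(g a, y), κ) from each y in E. This changes nothing on the
  -- range of R, where d(g a, y) ≥ κ, and keeps the point off B because κ > 0.
  obtain ⟨ψ, hψ, hψs⟩ := exists_extend_embedding (U := U) (ι := Option E)
    (fun i j => match i, j with
      | none, none => 0
      | none, some y => max (dist (g a) y) κ
      | some y, none => max (dist (g a) y) κ
      | some y, some z => dist (y : U) z)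
    (by rintro (_ | y) <;> simp)
    (by rintro (_ | y) (_ | z) <;> simp [dist_comm])
    (by
      rintro (_ | y) (_ | z) (_ | w) <;> simp only
      · simp
      · simp
      · have := le_max_right (dist (g a) z) (κ : ℝ)
        linarith
      · rcases max_cases (dist (g a) (w : U)) (κ : ℝ) with h | h
        · have := dist_triangle (g a) (z : U) w
          have := le_max_left (dist (g a) z) (κ : ℝ)
          linarith
        · have := le_max_right (dist (g a) z) (κ : ℝ)
          have : 0 ≤ dist (z : U) w := dist_nonneg
          linarith
      · simp
      · have := le_max_left (dist (g a) y) (κ : ℝ)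
        have := le_max_left (dist (g a) w) (κ : ℝ)
        have := dist_triangle_left (y : U) w (g a)
        linarith
      · rcases max_cases (dist (g a) (y : U)) (κ : ℝ) with h | h
        · have := dist_triangle (g a) (z : U) y
          rw [dist_comm (z : U) y] at this
          have := le_max_left (dist (g a) z) (κ : ℝ)
          linarith
        · have := le_max_right (dist (g a) z) (κ : ℝ)
          have : 0 ≤ dist (y : U) z := dist_nonneg
          linarith
      · exact dist_triangle _ _ _)
    (by
      rintro (_ | y) (_ | z) <;> simp only
      · exact ⟨0, by simp⟩
      · obtain ⟨q, hq⟩ := exists_dist_eq_ratCast (g a) (z : U)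
        exact ⟨max q κ, by rw [hq]; push_cast; rfl⟩
      · obtain ⟨q, hq⟩ := exists_dist_eq_ratCast (g a) (y : U)
        exact ⟨max q κ, by rw [hq]; push_cast; rfl⟩
      · exact exists_dist_eq_ratCast _ _)
    (Set.range some) (fun i => i.elim a (↑))
    (by rintro _ ⟨y, rfl⟩ _ ⟨z, rfl⟩; rfl)
  have hψ' : ∀ y : E, ψ (some y) = y := fun y => hψs _ ⟨y, rfl⟩
  have key : ∀ p ∈ R, dist (ψ none) p.2 = dist a p.1 := fun p hp => by
    have h := hψ none (some ⟨p.2, Or.inl ⟨p, hp, rfl⟩⟩)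
    rw [hψ'] at h
    simp only at h
    rw [h, max_eq_left (hκR p hp), ← hg p hp, g.dist_eq]
  refine ⟨ψ none, fun hmem => ?_, ?_⟩
  · have h := hψ none (some ⟨ψ none, Or.inr hmem⟩)
    rw [hψ'] at h
    simp only [dist_self] at h
    have := le_max_right (dist (g a) (ψ none)) (κ : ℝ)
    linarith
  · rintro p (rfl | hp) q (rfl | hq)
    · simp
    · exact key q hq
    · rw [dist_comm, key p hp, dist_comm]
    · exact hR p hp q hq

end PartialIsometries

/-! ### Graded partial isometries and the construction of g -/

section Graded

variable {U : Type*}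

/-- The grading `t` increases by one along the relation `R`; in particular `R` has no cycles. -/
def IsGraded (R : Set (U × U)) (t : U → ℤ) : Prop := ∀ p ∈ R, t p.2 = t p.1 + 1

theorem min_max_triangle {c a₁ a₂ a₃ b₁ b₂ b₃ : ℝ} (hc : 0 ≤ c) (ha₁ : 0 ≤ a₁) (ha₂ : 0 ≤ a₂)
    (ha : a₃ ≤ a₁ + a₂) (hb : b₃ ≤ b₁ + b₂) :
    min c (max a₃ b₃) ≤ min c (max a₁ b₁) + min c (max a₂ b₂) := by
  have h₁ : 0 ≤ min c (max a₁ b₁) := le_min hc (le_max_of_le_left ha₁)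
  have h₂ : 0 ≤ min c (max a₂ b₂) := le_min hc (le_max_of_le_left ha₂)
  rcases min_choice c (max a₁ b₁) with h | h
  · have := min_le_left c (max a₃ b₃)
    linarith
  rcases min_choice c (max a₂ b₂) with h' | h'
  · have := min_le_left c (max a₃ b₃)
    linarith
  rw [h, h']
  refine (min_le_right _ _).trans (max_le ?_ ?_)
  · exact ha.trans (add_le_add (le_max_left _ _) (le_max_left _ _))
  · exact hb.trans (add_le_add (le_max_right _ _) (le_max_right _ _))

theorem exists_nat_bound_finite {E : Set U} (hE : E.Finite) (φ : U → U → ℝ) :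
    ∃ c : ℕ, 0 < c ∧ ∀ x ∈ E, ∀ y ∈ E, φ x y ≤ c := by
  have h : ∀ᶠ c : ℕ in Filter.atTop, ∀ x ∈ E, ∀ y ∈ E, φ x y ≤ c :=
    (Filter.eventually_all_finite hE).2 fun x _ => (Filter.eventually_all_finite hE).2 fun y _ =>
      tendsto_natCast_atTop_atTop.eventually_ge_atTop _
  exact ((Filter.eventually_gt_atTop 0).and h).exists

variable [MetricSpace U]

theorem exists_nat_grading_le_mul_dist {E : Set U} (hE : E.Finite) (t : U → ℤ) :
    ∃ m : ℕ, 0 < m ∧ ∀ x ∈ E, ∀ y ∈ E, |(t x : ℝ) - t y| ≤ m * dist x y := by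
  have h : ∀ᶠ m : ℕ in Filter.atTop, ∀ x ∈ E, ∀ y ∈ E, |(t x : ℝ) - t y| ≤ m * dist x y := by
    refine (Filter.eventually_all_finite hE).2 fun x _ =>
      (Filter.eventually_all_finite hE).2 fun y _ => ?_
    rcases eq_or_ne x y with rfl | hxy
    · simp
    · exact (tendsto_natCast_atTop_atTop.atTop_mul_const (dist_pos.2 hxy)).eventually_ge_atTop _
  obtain ⟨m, hm, h⟩ := ((Filter.eventually_gt_atTop 0).and h).exists
  exact ⟨m, hm, h⟩

/-- Every finite part of the space is moved by some power of `g` to constant distance from itself. -/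
def MovesToConstantDistance (g : U ≃ᵢ U) : Prop :=
  ∀ F : Set U, F.Finite → ∃ (n : ℕ) (c : ℝ), ∀ a ∈ F, ∀ b ∈ F, dist ((g ^ n) a) b = c

variable [RationalUrysohnSpace U]

/-- A finite graded partial isometry extends to one that is defined on a given finite set `F`, whose
inverse is defined on `F`, and some power of which moves `F` to constant distance from itself. -/
theorem exists_graded_extension {R : Set (U × U)} (hR : IsPartialIsometry R) (hfin : R.Finite)
    {t : U → ℤ} (ht : IsGraded R t) {F : Set U} (hF : F.Finite) :
    ∃ R' : Set (U × U), R ⊆ R' ∧ IsPartialIsometry R' ∧ R'.Finite ∧ (∃ t', IsGraded R' t') ∧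
      (∀ x ∈ F, ∃ y, (x, y) ∈ R') ∧ (∀ y ∈ F, ∃ x, (x, y) ∈ R') ∧
      ∀ g : U ≃ᵢ U, Extends g R' → ∃ (n : ℕ) (c : ℝ), ∀ a ∈ F, ∀ b ∈ F,
        dist ((g ^ n) a) b = c := by
  obtain ⟨g₀, hg₀⟩ := hR.exists_equiv hfin
  set E : Set U := F ∪ (Prod.fst '' R ∪ Prod.snd '' R) with hEdef
  have hE : E.Finite := hF.union ((hfin.image _).union (hfin.image _))
  have hEF : F ⊆ E := Set.subset_union_left
  have hE1 : ∀ p ∈ R, p.1 ∈ E := fun p hp => Or.inr (Or.inl ⟨p, hp, rfl⟩)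
  have hE2 : ∀ p ∈ R, p.2 ∈ E := fun p hp => Or.inr (Or.inr ⟨p, hp, rfl⟩)
  have : Finite E := hE.to_subtype
  -- Here t is m-Lipschitz on E, c bounds the diameter of E, and n steps raise the grading enough to
  -- force distance c.
  obtain ⟨m, hm, htm⟩ := exists_nat_grading_le_mul_dist hE t
  obtain ⟨c, hc0, hc⟩ := exists_nat_bound_finite hE dist
  obtain ⟨n, hn0, hn⟩ := exists_nat_bound_finite hE fun x y => (c * m : ℝ) + t y - t x
  have hm' : (0 : ℝ) < m := by exact_mod_cast hm
  -- Layer i stands for g₀^(i-1) E with grading t + i, so layer 1 is E itself. The pseudometric σ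
  -- compares positions and gradings and is truncated at c. It is shift-invariant and, by the choice
  -- of m and c, restricts to the given metric on layer 1. Layer 0 serves to put F in the range.
  let ι := E × Fin (n + 2)
  let τ : ι → ℤ := fun z => t z.1 + ((z.2 : ℕ) : ℤ)
  let π : ι → U := fun z => (g₀ ^ (((z.2 : ℕ) : ℤ) - 1)) z.1
  let σ : ι → ι → ℝ := fun z w => min (c : ℝ) (max (dist (π z) (π w)) (|(τ z : ℝ) - τ w| / m))
  let o : Fin (n + 2) := ⟨1, by omega⟩
  have hπo : ∀ x : E, π (x, o) = x := fun x => by simp [π, o]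
  have hσo : ∀ x y : E, σ (x, o) (y, o) = dist (x : U) y := fun x y => by
    have h1 : |(t x : ℝ) - t y| / m ≤ dist (x : U) y := by
      rw [div_le_iff₀' hm']
      exact htm _ x.2 _ y.2
    simp only [σ, hπo]
    simp only [τ, Int.cast_add, add_sub_add_right_eq_sub]
    rw [max_eq_left h1, min_eq_right (hc _ x.2 _ y.2)]
  obtain ⟨ψ, hψ, hψo⟩ := exists_extend_embedding (U := U) (ι := ι) σ
    (fun z => by simp [σ])
    (fun z w => by simp only [σ]; rw [dist_comm, abs_sub_comm])
    (fun z w v => min_max_triangle (Nat.cast_nonneg _) dist_nonneg dist_nonneg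
      (dist_triangle _ _ _) (by
        rw [← add_div]
        exact div_le_div_of_nonneg_right (abs_sub_le _ _ _) hm'.le))
    (fun z w => by
      obtain ⟨q, hq⟩ := exists_dist_eq_ratCast (π z) (π w)
      exact ⟨min (c : ℚ) (max q (|(τ z : ℚ) - τ w| / m)), by simp only [σ]; rw [hq]; push_cast; rfl⟩)
    (Set.range fun x : E => (x, o)) (fun z => z.1)
    (by
      rintro _ ⟨x, rfl⟩ _ ⟨y, rfl⟩
      exact (hσo x y).symm)
  have hψo' : ∀ x : E, ψ (x, o) = x := fun x => hψo _ ⟨x, rfl⟩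
  have hψeq : ∀ z w, π z = π w → τ z = τ w → ψ z = ψ w := fun z w h1 h2 => by
    rw [← dist_eq_zero, hψ]
    simp [σ, h1, h2]
  -- As c > 0, points at σ-distance 0 have equal grading, so the grading descends to the image.
  have hτψ : Function.FactorsThrough τ ψ := fun z w h => by
    have h0 := hψ z w
    rw [h, dist_self] at h0
    by_contra hne
    have hpos : (0 : ℝ) < |(τ z : ℝ) - τ w| / m :=
      div_pos (abs_pos.2 (sub_ne_zero.2 (by exact_mod_cast hne))) hm'
    have : (0 : ℝ) < σ z w := lt_min (by exact_mod_cast hc0) (lt_max_of_lt_right hpos)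
    linarith
  have hπs : ∀ (x : E) (i : Fin (n + 1)), π (x, i.succ) = g₀ (π (x, i.castSucc)) := fun x i => by
    simp only [π, Fin.val_succ, Fin.val_castSucc]
    rw [← IsometryEquiv.mul_apply, ← zpow_one_add]
    congr 2
    push_cast
    ring
  have hτs : ∀ (x : E) (i : Fin (n + 1)), τ (x, i.succ) = τ (x, i.castSucc) + 1 := fun x i => by
    simp only [τ, Fin.val_succ, Fin.val_castSucc]
    push_cast
    ring
  let e : E × Fin (n + 1) → U × U := fun z => (ψ (z.1, z.2.castSucc), ψ (z.1, z.2.succ))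
  let i₁ : Fin (n + 1) := ⟨1, by omega⟩
  have hi₁ : i₁.castSucc = o := rfl
  have hmem : ∀ x : E, ((x : U), ψ (x, i₁.succ)) ∈ Set.range e := fun x => ⟨(x, i₁), by
    simp only [e]
    rw [hi₁, hψo']⟩
  refine ⟨Set.range e, fun p hp => ?_, ?_, Set.finite_range e,
    ⟨Function.extend ψ τ 0, ?_⟩, fun x hx => ?_, fun x hx => ?_, fun g hg => ?_⟩
  -- An arrow of R survives: p.1 in layer 2 and p.2 in layer 1 have the same position and, R being
  -- graded, the same τ.
  · convert hmem ⟨p.1, hE1 p hp⟩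
    have : ψ (⟨p.1, hE1 p hp⟩, i₁.succ) = ψ (⟨p.2, hE2 p hp⟩, o) := by
      refine hψeq _ _ ?_ ?_
      · rw [hπs, hi₁, hπo, hπo]
        exact hg₀ p hp
      · rw [hτs, hi₁]
        simp only [τ]
        rw [ht p hp]
        ring
    rw [this, hψo']
  · rintro _ ⟨⟨x, i⟩, rfl⟩ _ ⟨⟨y, j⟩, rfl⟩
    simp only [e, hψ, σ, hπs, hτs, g₀.dist_eq]
    push_cast
    rw [add_sub_add_right_eq_sub]
  · rintro _ ⟨⟨x, i⟩, rfl⟩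
    simp only [e]
    rw [hτψ.extend_apply, hτψ.extend_apply, hτs]
  · exact ⟨_, hmem ⟨x, hEF hx⟩⟩
  · exact ⟨ψ (⟨x, hEF hx⟩, (0 : Fin (n + 1)).castSucc), (⟨x, hEF hx⟩, 0),
      Prod.ext rfl (hψo' ⟨x, hEF hx⟩)⟩
  · have hpow : ∀ (x : E) (k : ℕ) (hk : k + 1 < n + 2), (g ^ k) x = ψ (x, ⟨k + 1, hk⟩) := by
      intro x k
      induction k with
      | zero => exact fun _ => (hψo' x).symm
      | succ k ih =>
        intro hk
        rw [pow_succ', IsometryEquiv.mul_apply, ih (by omega)]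
        exact hg _ ⟨(x, ⟨k + 1, by omega⟩), rfl⟩
    -- Between layers n + 1 and 1 the gradings differ by at least c * m, so the truncation gives
    -- exactly c.
    refine ⟨n, c, fun a ha b hb => ?_⟩
    have h := hψ (⟨a, hEF ha⟩, ⟨n + 1, by omega⟩) (⟨b, hEF hb⟩, o)
    rw [hψo', ← hpow] at h
    rw [h]
    refine min_eq_left (le_max_of_le_right ?_)
    rw [le_div_iff₀ hm']
    refine le_trans ?_ (le_abs_self _)
    have := hn a (hEF ha) b (hEF hb)
    simp only [τ, o]
    push_cast
    linarith

theorem exists_movesToConstantDistance (U : Type*) [MetricSpace U] [RationalUrysohnSpace U] :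
    ∃ g : U ≃ᵢ U, MovesToConstantDistance g := by
  have hfin : ∃ F : ℕ → Set U, (∀ k, (F k).Finite) ∧
      ∀ S : Set U, S.Finite → ∃ k, S ⊆ F k := by
    have : Countable (Finset U) := inferInstance
    obtain ⟨e, he⟩ := exists_surjective_nat (Finset U)
    exact ⟨fun k => e k, fun k => (e k).finite_toSet, fun S hS => by
      obtain ⟨k, hk⟩ := he hS.toFinset
      exact ⟨k, by simp [hk]⟩⟩
  obtain ⟨F, hF, hcof⟩ := hfin
  let P := {R : Set (U × U) // IsPartialIsometry R ∧ R.Finite ∧ ∃ t, IsGraded R t}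
  have hstep : ∀ (k : ℕ) (R : P), ∃ R' : P, R.1 ⊆ R'.1 ∧ (∀ x ∈ F k, ∃ y, (x, y) ∈ R'.1) ∧
      (∀ y ∈ F k, ∃ x, (x, y) ∈ R'.1) ∧
      ∀ g : U ≃ᵢ U, Extends g R'.1 → ∃ (n : ℕ) (c : ℝ), ∀ a ∈ F k, ∀ b ∈ F k,
        dist ((g ^ n) a) b = c := by
    rintro k ⟨R, hR, hRfin, t, ht⟩
    obtain ⟨R', h, h1, h2, h3, h4⟩ := exists_graded_extension hR hRfin ht (hF k)
    exact ⟨⟨R', h1, h2, h3⟩, h, h4⟩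
  choose next hsub hdom hran hconst using hstep
  let R : ℕ → P := Nat.rec ⟨∅, by simp [IsPartialIsometry], Set.finite_empty, 0, by simp [IsGraded]⟩ next
  have hmono : Monotone fun k => (R k).1 := monotone_nat_of_le_succ fun k => hsub k (R k)
  have hiso : IsPartialIsometry (⋃ k, (R k).1) := by
    intro p hp q hq
    obtain ⟨i, hi⟩ := Set.mem_iUnion.1 hp
    obtain ⟨j, hj⟩ := Set.mem_iUnion.1 hq
    exact (R (max i j)).2.1 p (hmono (le_max_left i j) hi) q (hmono (le_max_right i j) hj)
  obtain ⟨g, hg⟩ := hiso.exists_equiv_of_total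
    (fun x => by
      obtain ⟨k, hk⟩ := hcof {x} (Set.finite_singleton x)
      obtain ⟨y, hy⟩ := hdom k (R k) x (hk rfl)
      exact ⟨y, Set.mem_iUnion.2 ⟨k + 1, hy⟩⟩)
    (fun y => by
      obtain ⟨k, hk⟩ := hcof {y} (Set.finite_singleton y)
      obtain ⟨x, hx⟩ := hran k (R k) y (hk rfl)
      exact ⟨x, Set.mem_iUnion.2 ⟨k + 1, hx⟩⟩)
  refine ⟨g, fun S hS => ?_⟩
  obtain ⟨k, hk⟩ := hcof S hS
  obtain ⟨n, c, h⟩ := hconst k (R k) g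
    (hg.mono (Set.subset_iUnion (fun k => (R k).1) (k + 1)))
  exact ⟨n, c, fun a ha b hb => h a (hk ha) b (hk hb)⟩

end Graded

/-! ### Words in an automorphism and a variable -/

theorem isometryEquiv_one_apply {U : Type*} [MetricSpace U] (x : U) : (1 : U ≃ᵢ U) x = x := rfl

section Words

variable {U : Type*} [MetricSpace U] [RationalUrysohnSpace U]

theorem IsPartialIsometry.exists_insert_symm {R : Set (U × U)} (hR : IsPartialIsometry R)
    (hfin : R.Finite) {a : U} (ha : ∀ p ∈ R, p.2 ≠ a) {B : Set U} (hB : B.Finite) :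
    ∃ b ∉ B, IsPartialIsometry (insert (b, a) R) := by
  obtain ⟨b, hb, h⟩ := IsPartialIsometry.exists_insert (R := Prod.swap '' R) (a := a)
    (by
      rintro _ ⟨p, hp, rfl⟩ _ ⟨q, hq, rfl⟩
      exact (hR p hp q hq).symm)
    (hfin.image _)
    (by
      rintro _ ⟨p, hp, rfl⟩
      exact ha p hp) hB
  refine ⟨b, hb, fun p hp q hq => (h p.swap ?_ q.swap ?_).symm⟩
  · exact hp.imp (fun h => by rw [h]; rfl) fun h => ⟨p, h, rfl⟩
  · exact hq.imp (fun h => by rw [h]; rfl) fun h => ⟨q, h, rfl⟩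

/-- A periodic orbit together with an extra point b is finite. Some power of g then moves it to
constant distance, which must be 0 because g^n a lies in the orbit; this forces b = a. -/
theorem MovesToConstantDistance.pow_apply_ne {g : U ≃ᵢ U} (hg : MovesToConstantDistance g)
    {m : ℕ} (hm : 0 < m) (a : U) : (g ^ m) a ≠ a := by
  intro h
  obtain ⟨b, hb, -⟩ := IsPartialIsometry.exists_insert (R := ∅) (a := a) (B := {a})
    (by simp [IsPartialIsometry]) Set.finite_empty (by simp) (Set.finite_singleton a)
  have hmul : ∀ k : ℕ, (g ^ (m * k)) a = a := fun k => by
    induction k with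
    | zero => simp
    | succ k ih => rw [mul_add, mul_one, pow_add, IsometryEquiv.mul_apply, h, ih]
  obtain ⟨n, c, hn⟩ := hg (insert b ((fun i : ℕ => (g ^ i) a) '' Set.Iio m))
    (((Set.finite_Iio m).image _).insert b)
  have hmem : ∀ i : ℕ, (g ^ i) a ∈ insert b ((fun i : ℕ => (g ^ i) a) '' Set.Iio m) := fun i =>
    Or.inr ⟨i % m, Nat.mod_lt _ hm, by
      conv_rhs => rw [← Nat.mod_add_div i m, pow_add, IsometryEquiv.mul_apply, hmul]⟩
  have ha := hmem 0
  rw [pow_zero, isometryEquiv_one_apply] at ha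
  have hc := hn a ha _ (hmem n)
  rw [dist_self] at hc
  have h1 := hn a ha b (Set.mem_insert _ _)
  have h2 := hn a ha a ha
  rw [← hc, dist_eq_zero] at h1 h2
  exact hb (h1.symm.trans h2)

theorem MovesToConstantDistance.zpow_apply_ne {g : U ≃ᵢ U} (hg : MovesToConstantDistance g)
    {j : ℤ} (hj : j ≠ 0) (a : U) : (g ^ j) a ≠ a := by
  intro h
  have hpos : 0 < j.natAbs := Int.natAbs_pos.2 hj
  rcases Int.natAbs_eq j with h' | h'
  · rw [h', zpow_natCast] at h
    exact hg.pow_apply_ne hpos a h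
  · rw [h', zpow_neg, zpow_natCast] at h
    refine hg.pow_apply_ne hpos a ?_
    conv_lhs => rw [← h]
    exact IsometryEquiv.apply_inv_self _ _

/-- The value of a letter of a word at the pair `(g, x)`. -/
def letterValue {G : Type*} [Group G] (g x : G) (s : Fin 2 × Bool) : G :=
  cond s.2 (![g, x] s.1) (![g, x] s.1)⁻¹

/-- The sign of a letter. -/
def letterSign (β : Bool) : ℤ := cond β 1 (-1)

theorem letterSign_mul_self (β : Bool) : letterSign β * letterSign β = 1 := by
  cases β <;> rfl

/-- A word in `g` and a variable `x` can be followed along a path of fresh points that starts at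
`a`, by prescribing finitely many values of `x`. -/
theorem MovesToConstantDistance.exists_path {g : U ≃ᵢ U} (hg : MovesToConstantDistance g)
    (a : U) (N : ℕ) (L : List (Fin 2 × Bool)) (hL : FreeGroup.IsReduced L) (hN : L.length ≤ N) :
    ∃ (R : Set (U × U)) (S : Set U) (b : U) (k : ℤ),
      IsPartialIsometry R ∧ R.Finite ∧ S.Finite ∧ a ∈ S ∧ (∀ p ∈ R, p.1 ∈ S ∧ p.2 ∈ S) ∧
      (∀ j : ℤ, j ≠ 0 → |j| ≤ N → (g ^ j) b ∉ S) ∧ |k| ≤ L.length ∧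
      (∀ x : U ≃ᵢ U, Extends x R → (L.map (letterValue g x)).prod a = (g ^ k) b) ∧
      (k = 0 → L ≠ [] → b ≠ a) ∧
      (∀ β, FreeGroup.IsReduced ((0, β) :: L) → 0 ≤ k * letterSign β) ∧
      ∀ β, FreeGroup.IsReduced ((1, β) :: L) → k = 0 → ∀ p ∈ R, cond β p.1 p.2 ≠ b := by
  induction L with
  | nil =>
    refine ⟨∅, {a}, a, 0, by simp [IsPartialIsometry], Set.finite_empty, Set.finite_singleton a,
      rfl, by simp, fun j hj _ => hg.zpow_apply_ne hj a, by simp, by simp, by simp, by simp,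
      by simp⟩
  | cons s L ih =>
    have hL' : FreeGroup.IsReduced L := List.IsChain.tail hL
    rw [List.length_cons] at hN
    obtain ⟨R, S, b, k, hR, hRf, hSf, haS, hRS, hfresh, hk, hval, hba, h0, h1⟩ :=
      ih hL' (by omega)
    obtain ⟨i, β⟩ := s
    have hred : ∀ i' β', FreeGroup.IsReduced ((i', β') :: (i, β) :: L) → i' = i → β' = β :=
      fun i' β' h => (List.isChain_cons_cons.1 h).1
    fin_cases i
    -- A letter g only changes k. In a reduced word consecutive letters g do not cancel, so k moves
    -- away from 0.
    · have hpos := h0 β hL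
      have hss := letterSign_mul_self β
      have hne : k + letterSign β ≠ 0 := fun h => by
        have : (k + letterSign β) * letterSign β = 0 := by rw [h, zero_mul]
        rw [add_mul, hss] at this
        omega
      refine ⟨R, S, b, k + letterSign β, hR, hRf, hSf, haS, hRS, hfresh, ?_, fun x hx => ?_,
        fun h => absurd h hne, fun β' h => ?_, fun _ _ h => absurd h hne⟩
      · refine (abs_add_le _ _).trans ?_
        have : |letterSign β| = 1 := by cases β <;> rfl
        rw [this, List.length_cons]
        push_cast
        omega
      · rw [List.map_cons, List.prod_cons, IsometryEquiv.mul_apply, hval x hx,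
          ← IsometryEquiv.mul_apply, add_comm, zpow_add]
        congr 2
        cases β <;> simp [letterValue, letterSign]
      · rw [hred _ _ h rfl, add_mul, hss]
        omega
    · set v := (g ^ k) b with hv
      -- The letter x^±1 is still unprescribed at v: for k ≠ 0 by freshness of b, for k = 0 because
      -- the word is reduced.
      have hfree : ∀ p ∈ R, cond β p.1 p.2 ≠ v := by
        intro p hp
        rcases eq_or_ne k 0 with hk0 | hk0
        · rw [hv, hk0, zpow_zero, isometryEquiv_one_apply]
          exact h1 β hL hk0 p hp
        · intro h
          refine hfresh k hk0 (hk.trans (by exact_mod_cast (by omega))) ?_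
          rw [← hv, ← h]
          cases β
          exacts [(hRS p hp).2, (hRS p hp).1]
      -- Avoiding all g-translates of S and v by exponents up to N makes the next point fresh for
      -- the rest of the word.
      set B : Set U := ⋃ j ∈ Set.Icc (-(N : ℤ)) N, (fun y => (g ^ j) y) '' insert v S with hB
      have hBf : B.Finite := (Set.finite_Icc _ _).biUnion fun j _ => (hSf.insert v).image _
      have hBmem : ∀ (j : ℤ) (y : U), |j| ≤ N → (g ^ j) y ∈ insert v S → y ∉ B → False :=
        fun j y hj hy hyB => hyB <| Set.mem_biUnion
          (x := -j) (by rw [abs_le] at hj; constructor <;> omega)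
          ⟨_, hy, by simp [← IsometryEquiv.mul_apply]⟩
      have hex : ∃ b' ∉ B, IsPartialIsometry (insert (cond β (v, b') (b', v)) R) := by
        cases β
        exacts [hR.exists_insert_symm hRf hfree hBf, hR.exists_insert hRf hfree hBf]
      obtain ⟨b', hb', hR'⟩ := hex
      have hb'S : b' ∉ insert v S := fun h => hBmem 0 b' (by simp) (by simpa using h) hb'
      refine ⟨_, insert b' (insert v S), b', 0, hR', hRf.insert _, (hSf.insert v).insert b',
        Or.inr (Or.inr haS), ?_, ?_, by simp; positivity, fun x hx => ?_, fun _ _ h => ?_,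
        fun _ _ => by simp, fun β' h _ => ?_⟩
      · rintro p (rfl | hp)
        · cases β <;> simp
        · exact ⟨Or.inr (Or.inr (hRS p hp).1), Or.inr (Or.inr (hRS p hp).2)⟩
      · rintro j hj hjN (h | h)
        · exact hg.zpow_apply_ne hj b' h
        · exact hBmem j b' hjN h hb'
      · rw [List.map_cons, List.prod_cons, IsometryEquiv.mul_apply,
          hval x (hx.mono (Set.subset_insert _ _)), zpow_zero, isometryEquiv_one_apply]
        have hxv := hx _ (Set.mem_insert _ _)
        cases β
        · change x⁻¹ v = b'
          change x b' = v at hxv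
          rw [← hxv, IsometryEquiv.inv_apply_self]
        · exact hxv
      · exact hb'S (by rw [h]; exact Or.inr haS)
      · rw [hred _ _ h rfl]
        rintro p (rfl | hp) hpb
        · refine hb'S (Or.inl ?_)
          cases β <;> exact hpb.symm
        · refine hb'S (Or.inr ?_)
          rw [← hpb]
          cases β
          exacts [(hRS p hp).2, (hRS p hp).1]

/-- No nontrivial word in `g` and a variable vanishes identically. -/
theorem MovesToConstantDistance.exists_lift_ne_one {g : U ≃ᵢ U} (hg : MovesToConstantDistance g)
    {w : FreeGroup (Fin 2)} (hw : w ≠ 1) : ∃ x : U ≃ᵢ U, FreeGroup.lift ![g, x] w ≠ 1 := by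
  obtain ⟨f, -⟩ := RationalUrysohnSpace.universal (U := U) Unit
    fun a b => ⟨0, by simp⟩
  set a := f ()
  obtain ⟨R, S, b, k, hR, hRf, -, haS, -, hfresh, hk, hval, hba, -⟩ :=
    hg.exists_path a _ w.toWord FreeGroup.isReduced_toWord le_rfl
  obtain ⟨x, hx⟩ := hR.exists_equiv hRf
  refine ⟨x, fun h => ?_⟩
  have h' := hval x hx
  rw [← FreeGroup.mk_toWord (x := w), FreeGroup.lift_mk] at h
  change (w.toWord.map (letterValue g x)).prod = 1 at h
  rw [h, isometryEquiv_one_apply] at h'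
  rcases eq_or_ne k 0 with rfl | hk0
  · exact hba rfl (by rwa [ne_eq, FreeGroup.toWord_eq_nil_iff]) (by simpa using h'.symm)
  · exact hfresh k hk0 hk (h' ▸ haS)

end Words

/-! ### Cyclic generation and free pairs in topological groups -/

section TopologicalGroups

variable {H H' : Type*} [Group H] [Group H']

theorem CyclicallyGenerates.map [TopologicalSpace H] [TopologicalSpace H'] {g h : H}
    (hgh : CyclicallyGenerates g h) (φ : H →* H') (hφ : Continuous φ) (hd : DenseRange φ) :
    CyclicallyGenerates (φ g) (φ h) := by
  have := hd.dense_image hφ hgh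
  rw [← Set.range_comp] at this
  have hcomp : (fun l : ℤ => φ g ^ l * φ h * φ g ^ (-l)) = φ ∘ fun l : ℤ => g ^ l * h * g ^ (-l) := by
    ext l
    simp
  rwa [CyclicallyGenerates, hcomp]

/-- For each basic open W, the h having some g^l-conjugate in W form an open set, dense by
transitivity; Baire category intersects these. -/
theorem exists_cyclicallyGenerates_of_transitive [TopologicalSpace H] [ContinuousMul H]
    [BaireSpace H] [SecondCountableTopology H] {g : H}
    (hg : ∀ V W : Set H, IsOpen V → V.Nonempty → IsOpen W → W.Nonempty →
      ∃ h ∈ V, ∃ l : ℤ, g ^ l * h * g ^ (-l) ∈ W) :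
    ∃ h, CyclicallyGenerates g h := by
  have hB := isBasis_countableBasis H
  let O : countableBasis H → Set H := fun W => ⋃ l : ℤ, {h | g ^ l * h * g ^ (-l) ∈ (W : Set H)}
  have hO : ∀ W, IsOpen (O W) := fun W => isOpen_iUnion fun l =>
    (isOpen_of_mem_countableBasis W.2).preimage
      (f := fun h => g ^ l * h * g ^ (-l)) (by fun_prop)
  have hOd : ∀ W, Dense (O W) := fun W => by
    rw [dense_iff_inter_open]
    intro V hV hVn
    obtain ⟨h, hhV, l, hl⟩ := hg V W hV hVn (isOpen_of_mem_countableBasis W.2)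
      (nonempty_of_mem_countableBasis W.2)
    exact ⟨h, hhV, Set.mem_iUnion.2 ⟨l, hl⟩⟩
  obtain ⟨h, hh⟩ := (dense_iInter_of_isOpen hO hOd).nonempty
  refine ⟨h, hB.dense_iff.2 fun W hW hWn => ?_⟩
  obtain ⟨l, hl⟩ := Set.mem_iUnion.1 (Set.mem_iInter.1 hh ⟨W, hW⟩)
  exact ⟨_, hl, l, rfl⟩

theorem continuous_lift_apply [TopologicalSpace H] [IsTopologicalGroup H] (g : H)
    (w : FreeGroup (Fin 2)) : Continuous fun x : H => FreeGroup.lift ![g, x] w := by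
  induction w using FreeGroup.induction_on with
  | C1 => simpa using continuous_const
  | of i => fin_cases i <;> simp [continuous_const, continuous_id']
  | inv_of i h => simp only [map_inv]; exact h.inv
  | mul u v hu hv => simp only [map_mul]; exact hu.mul hv

/-- A cyclically generating pair is free as soon as no nontrivial word in `g` and a variable
vanishes identically. -/
theorem CyclicallyGenerates.generatesFreeGroup [TopologicalSpace H] [IsTopologicalGroup H]
    [T2Space H] {g h : H} (hgh : CyclicallyGenerates g h)
    (hg : ∀ w : FreeGroup (Fin 2), w ≠ 1 → ∃ x : H, FreeGroup.lift ![g, x] w ≠ 1) :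
    GeneratesFreeGroup g h := by
  refine (injective_iff_map_eq_one _).2 fun w hw => ?_
  by_contra hne
  obtain ⟨x, hx⟩ := hg w hne
  -- This closed set contains every g^l h g^(-l), since conjugation by g^l fixes g; hence it is all
  -- of H.
  have hclosed : IsClosed {x : H | FreeGroup.lift ![g, x] w = 1} :=
    isClosed_eq (continuous_lift_apply g w) continuous_const
  refine hx (hclosed.closure_subset_iff.2 ?_ (hgh x))
  rintro _ ⟨l, rfl⟩
  have hconj : FreeGroup.lift ![g, g ^ l * h * g ^ (-l)] =
      (MulAut.conj (g ^ l)).toMonoidHom.comp (FreeGroup.lift ![g, h]) := by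
    refine FreeGroup.ext_hom _ _ fun i => ?_
    rw [MonoidHom.comp_apply, FreeGroup.lift_apply_of, FreeGroup.lift_apply_of]
    fin_cases i
    · change g = g ^ l * g * (g ^ l)⁻¹
      rw [← zpow_neg, ← zpow_add_one, ← zpow_add]
      simp
    · change g ^ l * h * g ^ (-l) = g ^ l * h * (g ^ l)⁻¹
      rw [zpow_neg]
  change FreeGroup.lift ![g, g ^ l * h * g ^ (-l)] w = 1
  rw [hconj, MonoidHom.comp_apply, hw, map_one]

theorem map_lift_pair (φ : H →* H') (g h : H) (w : FreeGroup (Fin 2)) :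
    φ (FreeGroup.lift ![g, h] w) = FreeGroup.lift ![φ g, φ h] w := by
  have : φ.comp (FreeGroup.lift ![g, h]) = FreeGroup.lift ![φ g, φ h] := by
    refine FreeGroup.ext_hom _ _ fun i => ?_
    fin_cases i <;> simp
  exact DFunLike.congr_fun this w

theorem GeneratesFreeGroup.of_map (φ : H →* H') {g h : H}
    (hφ : GeneratesFreeGroup (φ g) (φ h)) : GeneratesFreeGroup g h := fun w w' hw => hφ <| by
  rw [← map_lift_pair, ← map_lift_pair, hw]

end TopologicalGroups

/-! ### Groups of continuous functions on a compact space -/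

section ContinuousFunctions

theorem exists_nhds_one_forall_mem {K Y : Type*} [TopologicalSpace K] [CompactSpace K]
    [TopologicalSpace Y] [MetrizableSpace Y] [One Y] {s : Set C(K, Y)} (hs : s ∈ nhds 1) :
    ∃ O ∈ nhds (1 : Y), ∀ f : C(K, Y), (∀ k, f k ∈ O) → f ∈ s := by
  let _ := metrizableSpaceMetric Y
  obtain ⟨ε, hε, h⟩ := Metric.mem_nhds_iff.1 hs
  refine ⟨Metric.ball 1 (ε / 2), Metric.ball_mem_nhds _ (half_pos hε), fun f hf => h ?_⟩
  exact ((ContinuousMap.dist_le (half_pos hε).le).2 fun k => (hf k).le).trans_lt (half_lt_self hε)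

theorem baireSpace_continuousMap (K Y : Type*) [TopologicalSpace K] [CompactSpace K]
    [TopologicalSpace Y] [PolishSpace Y] : BaireSpace C(K, Y) := by
  let _ := upgradeIsCompletelyMetrizable Y
  infer_instance

variable {U : Type*} [MetricSpace U]

theorem exists_finite_of_mem_nhds_aut {g : U ≃ᵢ U} {V : Set (U ≃ᵢ U)} (hV : V ∈ nhds g) :
    ∃ F : Set U, F.Finite ∧ ∀ f : U ≃ᵢ U, (∀ u ∈ F, f u = g u) → f ∈ V := by
  rw [nhds_induced, Filter.mem_comap] at hV
  obtain ⟨W, hW, hWV⟩ := hV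
  rw [nhds_pi, Filter.mem_pi] at hW
  obtain ⟨F, hF, t, ht, htW⟩ := hW
  refine ⟨F, hF, fun f hf => hWV (htW fun u hu => ?_)⟩
  change toDiscrete (f u) ∈ t u
  rw [hf u hu]
  exact mem_of_mem_nhds (ht u)

theorem continuous_toDiscrete_apply (u : U) :
    Continuous fun g : U ≃ᵢ U => toDiscrete (g u) :=
  (continuous_apply (A := fun _ : U => DiscreteCopy U) u).comp continuous_induced_dom

variable {K : Type*} [TopologicalSpace K] [CompactSpace K]

/-- Translation by v reduces to neighbourhoods of 1, where the uniform metric supplies one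
neighbourhood in G valid for all k. -/
theorem exists_finite_of_mem_nhds_continuousMap [Countable U] [LocallyCompactSpace K]
    {v : C(K, U ≃ᵢ U)} {V : Set C(K, U ≃ᵢ U)}
    (hV : V ∈ nhds v) :
    ∃ F : Set U, F.Finite ∧ ∀ f : C(K, U ≃ᵢ U), (∀ k, ∀ u ∈ F, f k u = v k u) → f ∈ V := by
  have h1 : (fun f => v * f) ⁻¹' V ∈ nhds (1 : C(K, U ≃ᵢ U)) :=
    (continuous_const_mul v).continuousAt.preimage_mem_nhds (by simpa using hV)
  obtain ⟨O, hO, hOV⟩ := exists_nhds_one_forall_mem h1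
  obtain ⟨F, hF, h⟩ := exists_finite_of_mem_nhds_aut hO
  refine ⟨F, hF, fun f hf => ?_⟩
  have := hOV (v⁻¹ * f) fun k => h _ fun u hu => by
    rw [ContinuousMap.mul_apply, ContinuousMap.inv_apply, IsometryEquiv.mul_apply, hf k u hu,
      IsometryEquiv.inv_apply_self]
    rfl
  simpa using this

theorem finite_range_apply (v : C(K, U ≃ᵢ U)) (u : U) : (Set.range fun k => v k u).Finite :=
  (isCompact_iff_finite (X := DiscreteCopy U)).1 (isCompact_range
    ((continuous_toDiscrete_apply u).comp v.continuous))

variable [RationalUrysohnSpace U]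

theorem MovesToConstantDistance.exists_conj_mem [LocallyCompactSpace K] {g : U ≃ᵢ U} (hg : MovesToConstantDistance g)
    {V W : Set C(K, U ≃ᵢ U)} (hV : IsOpen V) (hVn : V.Nonempty) (hW : IsOpen W)
    (hWn : W.Nonempty) :
    ∃ h ∈ V, ∃ l : ℤ,
      ContinuousMap.const K g ^ l * h * ContinuousMap.const K g ^ (-l) ∈ W := by
  obtain ⟨v, hv⟩ := hVn
  obtain ⟨b, hb⟩ := hWn
  obtain ⟨F₁, hF₁, hFV⟩ := exists_finite_of_mem_nhds_continuousMap (hV.mem_nhds hv)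
  obtain ⟨F₂, hF₂, hFW⟩ := exists_finite_of_mem_nhds_continuousMap (hW.mem_nhds hb)
  set F := F₁ ∪ F₂
  have hF : F.Finite := hF₁.union hF₂
  have : Finite F := hF.to_subtype
  -- One power serves F and its images under all v k and b k, finitely many points by compactness of
  -- K. All mixed distances then equal the same c.
  obtain ⟨n, c, hn⟩ := hg (F ∪ ((⋃ u ∈ F, Set.range fun k => v k u) ∪
      ⋃ u ∈ F, Set.range fun k => b k u))
    (hF.union ((hF.biUnion fun u _ => finite_range_apply v u).union
      (hF.biUnion fun u _ => finite_range_apply b u)))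
  have hconst : ∀ u ∈ F, ∀ u' ∈ F, dist ((g ^ n) u) u' = c := fun u hu u' hu' =>
    hn _ (Or.inl hu) _ (Or.inl hu')
  have hconst' : ∀ k, ∀ u ∈ F, ∀ u' ∈ F, dist ((g ^ n) (v k u)) (b k u') = c :=
    fun k u hu u' hu' => hn _ (Or.inr (Or.inl (Set.mem_biUnion hu ⟨k, rfl⟩))) _
      (Or.inr (Or.inr (Set.mem_biUnion hu' ⟨k, rfl⟩)))
  let T := (F → DiscreteCopy U) × (F → DiscreteCopy U)
  -- The map h k should agree with v k on F and with g^(-n) (b k) g^n on g^(-n)F, so that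
  -- conjugating by g^n gives b k on F.
  let R : T → Set (U × U) := fun θ => Set.range (fun u : F => ((u : U), (θ.1 u : U))) ∪
    Set.range (fun u : F => ((g ^ n)⁻¹ (u : U), (g ^ n)⁻¹ (θ.2 u : U)))
  let Θ : K → T := fun k => (fun u => toDiscrete (v k u), fun u => toDiscrete (b k u))
  have hΘ : Continuous Θ :=
    (continuous_pi fun u : F => (continuous_toDiscrete_apply (u : U)).comp v.continuous).prodMk
      (continuous_pi fun u : F => (continuous_toDiscrete_apply (u : U)).comp b.continuous)
  have hmove : ∀ x y : U, dist x ((g ^ n)⁻¹ y) = dist ((g ^ n) x) y := fun x y => by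
    rw [← (g ^ n).dist_eq, IsometryEquiv.apply_inv_self]
  have hR : ∀ k, IsPartialIsometry (R (Θ k)) := by
    rintro k p (⟨u, rfl⟩ | ⟨u, rfl⟩) q (⟨u', rfl⟩ | ⟨u', rfl⟩)
    · exact (v k).dist_eq _ _
    · change dist (v k u) ((g ^ n)⁻¹ (b k u')) = dist (u : U) ((g ^ n)⁻¹ u')
      rw [hmove, hmove, hconst _ u.2 _ u'.2, hconst' k _ u.2 _ u'.2]
    · change dist ((g ^ n)⁻¹ (b k u)) (v k u') = dist ((g ^ n)⁻¹ (u : U)) u'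
      rw [dist_comm, dist_comm _ (u' : U), hmove, hmove, hconst _ u'.2 _ u.2,
        hconst' k _ u'.2 _ u.2]
    · change dist ((g ^ n)⁻¹ (b k u)) ((g ^ n)⁻¹ (b k u')) = dist ((g ^ n)⁻¹ (u : U)) ((g ^ n)⁻¹ u')
      rw [IsometryEquiv.dist_eq, IsometryEquiv.dist_eq, IsometryEquiv.dist_eq]
  -- The data θ range over a discrete space, so any choice of extension depends continuously on k;
  -- the value 1 is a filler for incompatible data.
  have hext : ∀ θ : T, ∃ x : U ≃ᵢ U, IsPartialIsometry (R θ) → Extends x (R θ) := fun θ => by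
    by_cases h : IsPartialIsometry (R θ)
    · obtain ⟨x, hx⟩ := h.exists_equiv ((Set.finite_range _).union (Set.finite_range _))
      exact ⟨x, fun _ => hx⟩
    · exact ⟨1, fun h' => absurd h' h⟩
  choose Φ hΦ using hext
  let h : C(K, U ≃ᵢ U) := ⟨fun k => Φ (Θ k), continuous_of_discreteTopology.comp hΘ⟩
  have hh : ∀ k, Extends (h k) (R (Θ k)) := fun k => hΦ _ (hR k)
  refine ⟨h, hFV h fun k u hu => hh k _ (Or.inl ⟨⟨u, Or.inl hu⟩, rfl⟩), n,
    hFW _ fun k u hu => ?_⟩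
  have hku : h k ((g ^ n)⁻¹ u) = (g ^ n)⁻¹ (b k u) := hh k _ (Or.inr ⟨⟨u, Or.inr hu⟩, rfl⟩)
  rw [ContinuousMap.mul_apply, ContinuousMap.mul_apply, ContinuousMap.zpow_apply,
    ContinuousMap.zpow_apply, ContinuousMap.const_apply, IsometryEquiv.mul_apply,
    IsometryEquiv.mul_apply, zpow_neg, zpow_natCast, hku, IsometryEquiv.apply_inv_self]

theorem MovesToConstantDistance.exists_cyclicallyGenerates [SecondCountableTopology K]
    [LocallyCompactSpace K] {g : U ≃ᵢ U} (hg : MovesToConstantDistance g) :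
    ∃ h : C(K, U ≃ᵢ U), CyclicallyGenerates (ContinuousMap.const K g) h := by
  have := baireSpace_continuousMap K (U ≃ᵢ U)
  exact exists_cyclicallyGenerates_of_transitive fun V W hV hVn hW hWn =>
    hg.exists_conj_mem hV hVn hW hWn

/-- Evaluation at a point as a homomorphism. -/
def evalHom {K : Type*} [TopologicalSpace K] (G : Type*) [Group G] [TopologicalSpace G] [IsTopologicalGroup G] (k : K) :
    C(K, G) →* G where
  toFun f := f k
  map_one' := rfl
  map_mul' _ _ := rfl

theorem MovesToConstantDistance.generatesFreeGroup_apply {K : Type*} [TopologicalSpace K] {g : U ≃ᵢ U}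
    (hg : MovesToConstantDistance g) {h : C(K, U ≃ᵢ U)}
    (hh : CyclicallyGenerates (ContinuousMap.const K g) h) (k : K) :
    GeneratesFreeGroup g (h k) :=
  (hh.map (evalHom (U ≃ᵢ U) k) (continuous_eval_const k) <| Function.Surjective.denseRange
    fun x => ⟨ContinuousMap.const K x, rfl⟩).generatesFreeGroup
      fun _ hw => hg.exists_lift_ne_one hw

end ContinuousFunctions

/-! ### Continuous functions in groups of measurable functions -/

section MeasurableFunctions

open Filter Topology

variable {X : Type*} [MeasurableSpace X] (μ : Measure X)

/-- Convergence in measure implies convergence in `L₀`. -/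
theorem tendsto_lZero {μ : Measure X} [IsProbabilityMeasure μ] {Y : Type*} [TopologicalSpace Y]
    [PolishSpace Y] {ι : Type*} {ℓ : Filter ι} {F : ι → LZero μ Y} {f : LZero μ Y}
    (hF : letI := upgradeIsCompletelyMetrizable Y
      ∀ η : ℝ, 0 < η → Tendsto (fun i => μ.real {x | η ≤ dist (F i x) (f x)}) ℓ (𝓝 0)) :
    Tendsto F ℓ (𝓝 f) := by
  let _ := upgradeIsCompletelyMetrizable Y
  refine tendsto_nhds_generateFrom_iff.2 ?_
  rintro _ ⟨h, δ, ε, hδ, hε, rfl⟩ hf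
  -- By continuity from below, the measure already exceeds 1 - ε at some radius below δ, leaving
  -- room for the triangle inequality.
  let A : ℕ → Set X := fun n => {x | dist (f x) (h x) < δ - 1 / ((n : ℝ) + 1)}
  have hA : Monotone A := fun m n hmn x hx => by
    have : 1 / ((n : ℝ) + 1) ≤ 1 / ((m : ℝ) + 1) := Nat.one_div_le_one_div hmn
    simp only [A, Set.mem_ofPred_eq] at hx ⊢
    linarith
  have hU : {x | dist (f x) (h x) < δ} ⊆ ⋃ n, A n := fun x hx => by
    obtain ⟨n, hn⟩ := exists_nat_one_div_lt (K := ℝ) (sub_pos.2 (show dist (f x) (h x) < δ from hx))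
    refine Set.mem_iUnion.2 ⟨n, ?_⟩
    simp only [A, Set.mem_ofPred_eq]
    linarith
  have hlim : Tendsto (fun n => μ.real (A n)) atTop (𝓝 (μ.real (⋃ n, A n))) :=
    (ENNReal.tendsto_toReal (measure_ne_top _ _)).comp (tendsto_measure_iUnion_atTop hA)
  have hf' : 1 - ε < μ.real (⋃ n, A n) := lt_of_lt_of_le hf (measureReal_mono hU)
  obtain ⟨n, hn⟩ := (hlim.eventually_const_lt hf').exists
  have hη : (0 : ℝ) < 1 / ((n : ℝ) + 1) := Nat.one_div_pos_of_nat
  filter_upwards [(hF _ hη).eventually_lt_const (sub_pos.2 hn)] with i hi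
  have hsub : A n ⊆ {x | dist (F i x) (h x) < δ} ∪ {x | 1 / ((n : ℝ) + 1) ≤ dist (F i x) (f x)} := by
    intro x hx
    by_contra hcon
    simp only [Set.mem_union, Set.mem_ofPred_eq, not_or, not_lt, not_le] at hcon
    simp only [A, Set.mem_ofPred_eq] at hx
    have := dist_triangle (F i x) (f x) (h x)
    linarith
  have h1 := (measureReal_mono hsub (μ := μ)).trans (measureReal_union_le _ _)
  change μ.real {x | dist (F i x) (h x) < δ} > 1 - ε
  linarith

/-! ### Approximation by continuous functions on a zero-dimensional space -/

section Approximation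

variable [IsProbabilityMeasure μ] {Y : Type*} [TopologicalSpace Y]
  {K : Type*} [TopologicalSpace K] [MeasurableSpace K]

/-- Clopen sets of `K` pulled back along `φ` are dense in the measure algebra. -/
theorem measureDense_preimage_isClopen [CompactSpace K] [T2Space K] [TotallyDisconnectedSpace K]
    [SecondCountableTopology K] [BorelSpace K] {φ : X → K} (hφ : MeasurableEmbedding φ) :
    μ.MeasureDense {s : Set X | ∃ C : Set K, IsClopen C ∧ s = φ ⁻¹' C} := by
  refine Measure.MeasureDense.of_generateFrom_isSetAlgebra_finite (X := X) (μ := μ) ⟨?_, ?_, ?_⟩ ?_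
  · exact ⟨∅, isClopen_empty, rfl⟩
  · rintro _ ⟨C, hC, rfl⟩
    exact ⟨Cᶜ, hC.compl, rfl⟩
  · rintro _ _ ⟨C, hC, rfl⟩ ⟨D, hD, rfl⟩
    exact ⟨C ∪ D, hC.union hD, rfl⟩
  · rw [← hφ.comap_eq, BorelSpace.measurable_eq (α := K),
      isTopologicalBasis_isClopen.borel_eq_generateFrom, MeasurableSpace.comap_generateFrom]
    congr 1
    ext s
    exact ⟨fun ⟨C, hC, h⟩ => ⟨C, hC, h.symm⟩, fun ⟨C, hC, h⟩ => ⟨C, hC, h.symm⟩⟩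

theorem exists_continuousMap_measure_ne_lt [Nonempty Y] [CompactSpace K] [T2Space K]
    [TotallyDisconnectedSpace K] [SecondCountableTopology K] [BorelSpace K] {φ : X → K}
    (hφ : MeasurableEmbedding φ) (s : SimpleFunc X Y) {r : ℝ} (hr : 0 < r) :
    ∃ f : C(K, Y), μ.real {x | f (φ x) ≠ s x} < r := by
  obtain ⟨ε, hε, hεr⟩ : ∃ ε : ℝ, 0 < ε ∧ s.range.card * ε < r := by
    refine ⟨r / (s.range.card + 1), by positivity, ?_⟩
    rw [mul_div_assoc', div_lt_iff₀ (by positivity)]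
    linarith
  have happ : ∀ y : Y, ∃ C : Set K, IsClopen C ∧ μ.real (symmDiff (s ⁻¹' {y}) (φ ⁻¹' C)) < ε := by
    intro y
    obtain ⟨_, ⟨C, hC, rfl⟩, h⟩ := (measureDense_preimage_isClopen μ hφ).approx _
      (s.measurableSet_fiber y) (measure_ne_top _ _) ε hε
    exact ⟨C, hC, by
      rw [measureReal_def]
      exact ENNReal.toReal_lt_of_lt_ofReal h⟩
  choose C hC hCμ using happ
  -- A Boolean vector with exactly one true entry selects that value of s; other vectors arise only
  -- on the error set.
  have hΦ : ∀ θ : s.range → Bool, ∃ z : Y, ∀ y : s.range, (∀ y', θ y' = true ↔ y' = y) → z = y := by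
    intro θ
    by_cases h : ∃ y : s.range, θ y = true
    · obtain ⟨y, hy⟩ := h
      exact ⟨y, fun y' h' => congrArg Subtype.val ((h' y).1 hy)⟩
    · exact ⟨Classical.arbitrary Y, fun y h' => absurd ⟨y, (h' y).2 rfl⟩ h⟩
  choose Φ hΦ using hΦ
  let f : C(K, Y) := ⟨fun k => Φ fun y : s.range => (C y).boolIndicator k,
    continuous_of_discreteTopology.comp (continuous_pi fun y : s.range =>
      (continuous_boolIndicator_iff_isClopen _).2 (hC y))⟩
  have hsub : {x | f (φ x) ≠ s x} ⊆ ⋃ y ∈ s.range, symmDiff (s ⁻¹' {y}) (φ ⁻¹' C y) := by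
    intro x hx
    by_contra hcon
    simp only [Set.mem_iUnion, not_exists] at hcon
    refine hx (hΦ _ ⟨s x, s.mem_range_self x⟩ fun y' => ?_)
    have h := hcon y' y'.2
    rw [Set.mem_symmDiff] at h
    rw [← Set.mem_iff_boolIndicator, Subtype.ext_iff]
    change φ x ∈ C y' ↔ (y' : Y) = s x
    change ¬(s x = y' ∧ φ x ∉ C y' ∨ φ x ∈ C y' ∧ s x ≠ y') at h
    rw [eq_comm (a := (y' : Y))]
    tauto
  refine ⟨f, lt_of_le_of_lt ?_ hεr⟩
  calc μ.real {x | f (φ x) ≠ s x}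
      ≤ μ.real (⋃ y ∈ s.range, symmDiff (s ⁻¹' {y}) (φ ⁻¹' C y)) := measureReal_mono hsub (measure_ne_top _ _)
    _ ≤ ∑ y ∈ s.range, μ.real (symmDiff (s ⁻¹' {y}) (φ ⁻¹' C y)) :=
        measureReal_biUnion_finset_le _ _
    _ ≤ ∑ _y ∈ s.range, ε := Finset.sum_le_sum fun y _ => (hCμ y).le
    _ = s.range.card * ε := by rw [Finset.sum_const, nsmul_eq_mul]

end Approximation

/-! ### The homomorphism from C(K, Y) to L₀(Y) -/

section Group

variable {K : Type*} [TopologicalSpace K] [MeasurableSpace K] [OpensMeasurableSpace K]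
  {Y : Type*} [Group Y] [TopologicalSpace Y] [IsTopologicalGroup Y]
  [PolishSpace Y]

/-- Composition of continuous functions with a fixed measurable map, as a homomorphism to the group
of classes of measurable functions. -/
def continuousMapToLZero {φ : X → K} (hφ : Measurable φ) : C(K, Y) →* LZero μ Y where
  toFun f := AEEqFun.mk (fun x => f (φ x))
    (f.continuous.stronglyMeasurable.comp_measurable hφ).aestronglyMeasurable
  map_one' := rfl
  map_mul' _ _ := rfl

theorem coeFn_continuousMapToLZero {φ : X → K} (hφ : Measurable φ) (f : C(K, Y)) :
    continuousMapToLZero μ hφ f =ᵐ[μ] fun x => f (φ x) :=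
  AEEqFun.coeFn_mk _ _

variable [IsProbabilityMeasure μ]

theorem continuous_continuousMapToLZero [CompactSpace K] {φ : X → K} (hφ : Measurable φ) :
    Continuous (continuousMapToLZero (Y := Y) μ hφ) := by
  let _ := upgradeIsCompletelyMetrizable Y
  refine continuous_iff_continuousAt.2 fun f => tendsto_lZero fun η hη => ?_
  refine tendsto_const_nhds.congr' ?_
  filter_upwards [Metric.ball_mem_nhds f hη] with f' hf'
  rw [eq_comm, measureReal_eq_zero_iff, ← nonpos_iff_eq_zero, ← compl_compl {x | _}]
  refine le_of_eq ?_
  rw [← mem_ae_iff]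
  filter_upwards [coeFn_continuousMapToLZero μ hφ f, coeFn_continuousMapToLZero μ hφ f']
    with x hx hx'
  change ¬ (η ≤ _)
  rw [hx, hx', not_le]
  exact (ContinuousMap.dist_apply_le_dist _).trans_lt hf'

theorem denseRange_continuousMapToLZero [CompactSpace K] [T2Space K]
    [TotallyDisconnectedSpace K] [SecondCountableTopology K] [BorelSpace K] {φ : X → K} (hφ : MeasurableEmbedding φ) :
    DenseRange (continuousMapToLZero (Y := Y) μ hφ.measurable) := by
  let _ := upgradeIsCompletelyMetrizable Y
  intro f₀
  have key : ∀ η : ℝ, 0 < η → ∃ f : C(K, Y),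
      μ.real {x | η ≤ dist (continuousMapToLZero μ hφ.measurable f x) (f₀ x)} < η := by
    intro η hη
    -- Two approximations, each costing η/2: f₀ by a simple function in measure, then that function
    -- by a continuous one off a small set.
    have hm := (tendstoInMeasure_iff_measureReal_dist.1 (tendstoInMeasure_of_tendsto_ae (μ := μ)
      (fun n => (f₀.stronglyMeasurable.approx n).stronglyMeasurable.aestronglyMeasurable)
      (Eventually.of_forall f₀.stronglyMeasurable.tendsto_approx))) η hη
    obtain ⟨n, hn⟩ := (hm.eventually_lt_const (half_pos hη)).exists
    set s := f₀.stronglyMeasurable.approx n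
    obtain ⟨f, hf⟩ := exists_continuousMap_measure_ne_lt μ hφ s (half_pos hη)
    refine ⟨f, ?_⟩
    have hle : μ.real {x | η ≤ dist (continuousMapToLZero μ hφ.measurable f x) (f₀ x)} ≤
        μ.real ({x | f (φ x) ≠ s x} ∪ {x | η ≤ dist (s x) (f₀ x)}) := by
      refine ENNReal.toReal_mono (measure_ne_top _ _) (measure_mono_ae ?_)
      filter_upwards [coeFn_continuousMapToLZero μ hφ.measurable f] with x hx hxη
      change η ≤ _ at hxη
      rw [hx] at hxη
      by_cases h : f (φ x) = s x
      · rw [h] at hxη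
        exact Or.inr hxη
      · exact Or.inl h
    have := measureReal_union_le (μ := μ) {x | f (φ x) ≠ s x} {x | η ≤ dist (s x) (f₀ x)}
    linarith
  choose f hf using fun n : ℕ => key (1 / ((n : ℝ) + 1)) Nat.one_div_pos_of_nat
  refine mem_closure_of_tendsto (f := fun n => continuousMapToLZero μ hφ.measurable (f n))
    (b := atTop) (tendsto_lZero fun η hη => ?_) (Eventually.of_forall fun n => ⟨_, rfl⟩)
  refine squeeze_zero' (Eventually.of_forall fun n => measureReal_nonneg) ?_
    tendsto_one_div_add_atTop_nhds_zero_nat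
  filter_upwards [(tendsto_one_div_add_atTop_nhds_zero_nat (𝕜 := ℝ)).eventually_lt_const hη]
    with n hn
  exact (measureReal_mono fun x hx => hn.le.trans hx).trans (hf n).le

/-- Freeness of a pair of continuous functions passes to the classes of measurable functions if it
holds pointwise. -/
theorem generatesFreeGroup_continuousMapToLZero {φ : X → K} (hφ : Measurable φ) {g h : C(K, Y)}
    (hgh : ∀ k, GeneratesFreeGroup (g k) (h k)) :
    GeneratesFreeGroup (continuousMapToLZero μ hφ g) (continuousMapToLZero μ hφ h) := by
  refine (injective_iff_map_eq_one _).2 fun w hw => ?_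
  rw [← map_lift_pair] at hw
  have hone := AEEqFun.coeFn_one (μ := μ) (β := Y)
  rw [← hw] at hone
  -- A relation holding almost everywhere holds at some point, where freeness applies.
  obtain ⟨x, hx⟩ := ((coeFn_continuousMapToLZero μ hφ _).symm.trans hone).exists
  exact (injective_iff_map_eq_one _).1 (hgh (φ x)) w
    ((map_lift_pair (evalHom Y (φ x)) g h w).symm.trans hx)

end Group

end MeasurableFunctions

/-! ### The main theorem -/

theorem mainTheorem6
    (U : Type*) [MetricSpace U] [RationalUrysohnSpace U]
    {X : Type*} [MeasurableSpace X] [StandardBorelSpace X]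
    (μ : Measure X) [IsProbabilityMeasure μ] [NullSingletonClass μ] :
    (∀ n : ℕ, 1 ≤ n →
      HasCyclicallyDenseConjClass (Fin n → (U ≃ᵢ U)) ∧
      ∃ g h : Fin n → (U ≃ᵢ U), CyclicallyGenerates g h ∧ GeneratesFreeGroup g h) ∧
    (HasCyclicallyDenseConjClass (LZero μ (U ≃ᵢ U)) ∧
      ∃ g h : LZero μ (U ≃ᵢ U), CyclicallyGenerates g h ∧ GeneratesFreeGroup g h) := by
  obtain ⟨g, hg⟩ := exists_movesToConstantDistance U
  refine ⟨fun n hn => ?_, ?_⟩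
  · obtain ⟨h, hh⟩ := hg.exists_cyclicallyGenerates (K := Fin n)
    let ev : C(Fin n, U ≃ᵢ U) →* (Fin n → (U ≃ᵢ U)) :=
      { toFun := fun f => f, map_one' := rfl, map_mul' := fun _ _ => rfl }
    have hcyc := hh.map ev (continuous_pi fun i => continuous_eval_const i)
      (Function.Surjective.denseRange fun f => ⟨⟨f, continuous_of_discreteTopology⟩, rfl⟩)
    exact ⟨⟨_, _, hcyc⟩, _, _, hcyc,
      .of_map (Pi.evalMonoidHom _ ⟨0, hn⟩) (hg.generatesFreeGroup_apply hh _)⟩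
  · obtain ⟨h, hh⟩ := hg.exists_cyclicallyGenerates (K := ℕ → Bool)
    -- An injective Borel map between standard Borel spaces is an embedding, so clopen sets of
    -- Cantor space pull back to a generating algebra on X.
    have hφ : MeasurableEmbedding (MeasurableSpace.mapNatBool X) :=
      (MeasurableSpace.measurable_mapNatBool X).measurableEmbedding
        (MeasurableSpace.injective_mapNatBool X)
    have hcyc := hh.map (continuousMapToLZero μ hφ.measurable)
      (continuous_continuousMapToLZero μ _) (denseRange_continuousMapToLZero μ hφ)
    exact ⟨⟨_, _, hcyc⟩, _, _, hcyc, generatesFreeGroup_continuousMapToLZero μ hφ.measurable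
      fun k => hg.generatesFreeGroup_apply hh k⟩
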